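/- Let $q,k\ge 2$ be integers with $(q,k)\ne(2,2)$, let $n=qk$ and $[n]=\{1,\dots,n\}$. A family $\mathcal F\subseteq 2^{[n]}$ is called union-$q$-efficient if every subfamily of $\mathcal F$ whose union is $[n]$ contains $q$ sets whose union is $[n]$; for unions, $\mathcal F$ is called non-trivial if $\bigcup_{A\in\mathcal F}A=[n]$. A family is called $q$-linked if any $q$ of its members have a common element, and $\mathcal H\subseteq 2^{[n]}$ is called $q$-Helly if all members of any $q$-linked subfamily of $\mathcal H$ have a common element; for intersections, $\mathcal H$ is called non-trivial if no element of $[n]$ lies in all members of $\mathcal H$. Two families on $[n]$ are isomorphic if a permutation of $[n]$ maps one onto the other. Let $\mathcal E\subseteq\binom{[n]}{k}$ be the family consisting of $q$ pairwise disjoint $k$-sets $B_1,\dots,B_q$ (so that $B_1\cup\dots\cup B_q=[n]$), together with all $k$-subsets of $[n]\setminus\{p_1,\dots,p_q\}$, where $p_i\in B_i$ is one fixed element for each $i$; up to isomorphism $\mathcal E$ does not depend on the choices. (1) Every non-trivial union-$q$-efficient family $\mathcal F\subseteq\binom{[n]}{k}$ satisfies $|\mathcal F|\le\binom{n-q}{k}+q$.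 The family $\mathcal E$ is non-trivial and union-$q$-efficient and attains this bound, and every family attaining it is isomorphic to $\mathcal E$. (2) Equivalently, in terms of complements: put $k'=(q-1)k$, so that $n=k'q/(q-1)$. Every non-trivial $q$-Helly family $\mathcal H\subseteq\binom{[n]}{k'}$ satisfies $|\mathcal H|\le\binom{n-q}{k}+q$. The family $\{[n]\setminus A: A\in\mathcal E\}$ is non-trivial and $q$-Helly and attains this bound, and every family attaining it is isomorphic to this one. -/

import Mathlib

/-- A family `F` of subsets of `[n]` is union-`q`-efficient: every subfamily `S` whose union
is `[n]` contains `q` sets whose union is already `[n]`. -/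
def UnionEfficient {n : ℕ} (q : ℕ) (F : Finset (Finset (Fin n))) : Prop :=
  ∀ S ⊆ F, S.sup id = Finset.univ → ∃ T ⊆ S, T.card = q ∧ T.sup id = Finset.univ

/-- Non-triviality for unions: the sets of `F` cover `[n]`. -/
def UnionNontrivial {n : ℕ} (F : Finset (Finset (Fin n))) : Prop :=
  F.sup id = Finset.univ

/-- `H` is `q`-linked: any `q` members of `H` have a common element. -/
def Linked {n : ℕ} (q : ℕ) (H : Finset (Finset (Fin n))) : Prop :=
  ∀ A : Fin q → Finset (Fin n), (∀ i, A i ∈ H) → ∃ x, ∀ i, x ∈ A i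

/-- `H` is a `q`-Helly family: every `q`-linked subfamily has a common element. -/
def HellyFamily {n : ℕ} (q : ℕ) (H : Finset (Finset (Fin n))) : Prop :=
  ∀ S ⊆ H, Linked q S → ∃ x, ∀ A ∈ S, x ∈ A

/-- Non-triviality for intersections: no element of `[n]` lies in all sets of `H`. -/
def InterNontrivial {n : ℕ} (H : Finset (Finset (Fin n))) : Prop :=
  ¬ ∃ x, ∀ A ∈ H, x ∈ A

/-- Two families on `[n]` are isomorphic if a permutation of `[n]` carries one to the other. -/
def FamilyIso {n : ℕ} (F G : Finset (Finset (Fin n))) : Prop :=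
  ∃ σ : Equiv.Perm (Fin n), F.image (fun A => A.image σ) = G

/-- The family of complements of the members of `F`. -/
def complFamily {n : ℕ} (F : Finset (Finset (Fin n))) : Finset (Finset (Fin n)) :=
  F.image (fun A => Finset.univ \ A)

/-- The `i`-th block `{ik, ik + 1, …, ik + k - 1}` of `{0, …, n - 1}`. -/
def block (n k i : ℕ) : Finset (Fin n) :=
  Finset.univ.filter (fun x => x.val / k = i)

/-- For `n = qk`: the `q` disjoint blocks of size `k`, the `i`-th with private element `ik`,
together with all `k`-subsets of the `n - q` elements that are not private
(those that `k` does not divide). -/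
def extremalFamily (n q k : ℕ) : Finset (Finset (Fin n)) :=
  (Finset.range q).image (block n k) ∪
    Finset.powersetCard k (Finset.univ.filter (fun x : Fin n => ¬ k ∣ x.val))

/-! ### Relations without an induced path on four vertices -/

section Cograph

variable {α : Type*}

/-! Since n = qk, any q sets of size k covering [n] partition it, so union-q-efficiency becomes:
every covering subfamily of F contains a partition. Let E be the set of members of F lying in some
partition contained in F, viewed as a graph under disjointness.

Exchanging members between partitions shows that this graph has no induced path on four vertices
(`PartitionEfficient.pathFree_disjoint`), so it is built from single vertices by joins and disjoint
unions. Hence every maximal clique meets every maximal independent set. Partitions are maximal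
cliques; so, for a maximal intersecting I ⊆ E, F \ I contains no partition and cannot cover. An
uncovered point has I as its exact star in F (`PartitionEfficient.exists_point`).

Because all sets have size k, no neighbourhood lies in that of a non-neighbour, which forces at
least |E| maximal independent sets (`PathFree.card_le_card_maxIndeps`). Their points form a set X
with |X| ≥ |E| that every member of F outside E avoids. So |F| ≤ m + C(n - m, k) with m = |X| ≥ q,
and by convexity m = q is optimal (`add_choose_le`). The only tie, m = n = 6, is excluded by the
clique sizes in the equality case of the graph bound. Equality then makes E a single partition, each
block of which has one point of X. The Helly form follows by complementation. -/

/-- The relation `r` has no induced path on four vertices inside `W`. -/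
def PathFree (r : α → α → Prop) (W : Finset α) : Prop :=
  ∀ a ∈ W, ∀ b ∈ W, ∀ c ∈ W, ∀ d ∈ W, r a b → r b c → r c d → a ≠ c → b ≠ d →
    ¬ r a c → ¬ r b d → r a d

/-- `I` is a maximal independent subset of `W` for the relation `r`. -/
def IsMaxIndep (r : α → α → Prop) (W I : Finset α) : Prop :=
  I ⊆ W ∧ (∀ a ∈ I, ∀ b ∈ I, ¬ r a b) ∧ ∀ w ∈ W, (∀ a ∈ I, ¬ r w a) → w ∈ I

/-- `K` is a maximal clique in `W` for the relation `r`. -/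
def IsMaxClique (r : α → α → Prop) (W K : Finset α) : Prop :=
  K ⊆ W ∧ (∀ a ∈ K, ∀ b ∈ K, a ≠ b → r a b) ∧ ∀ w ∈ W, (∀ a ∈ K, w ≠ a → r w a) → w ∈ K

/-- No vertex of `W` has its neighbourhood contained in that of a non-neighbour. -/
def NoDomination (r : α → α → Prop) (W : Finset α) : Prop :=
  ∀ a ∈ W, ∀ b ∈ W, a ≠ b → ¬ r a b → ∃ c ∈ W, r a c ∧ ¬ r b c

open Classical in
/-- The maximal independent subsets of `W`. -/
noncomputable def maxIndeps (r : α → α → Prop) (W : Finset α) : Finset (Finset α) :=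
  W.powerset.filter (IsMaxIndep r W)

theorem mem_maxIndeps {r : α → α → Prop} {W I : Finset α} :
    I ∈ maxIndeps r W ↔ IsMaxIndep r W I := by
  classical
  simp only [maxIndeps, Finset.mem_filter, Finset.mem_powerset, and_iff_right_iff_imp]
  exact fun h => h.1

theorem PathFree.mono {r : α → α → Prop} {W U : Finset α} (h : PathFree r W) (hU : U ⊆ W) :
    PathFree r U :=
  fun a ha b hb c hc d hd => h a (hU ha) b (hU hb) c (hU hc) d (hU hd)

/-- The complement of a path a, b, c, d is again a path, namely c, a, d, b. -/
theorem PathFree.compl {r : α → α → Prop} (hs : ∀ a b, r a b → r b a) {W : Finset α}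
    (h : PathFree r W) : PathFree (fun a b => a ≠ b ∧ ¬ r a b) W := by
  intro a ha b hb c hc d hd hab hbc hcd hac hbd hac' hbd'
  refine ⟨?_, fun had => ?_⟩
  · rintro rfl
    exact hac' ⟨hac, fun h' => hcd.2 (hs _ _ h')⟩
  · simp only [not_and, not_not] at hac' hbd'
    exact hbc.2 (hs _ _ (h c hc a ha d hd b hb (hs _ _ (hac' hac)) had (hs _ _ (hbd' hbd))
      hcd.1 hab.1 hcd.2 hab.2))

theorem IsMaxIndep.nonempty {r : α → α → Prop} {W I : Finset α} (h : IsMaxIndep r W I)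
    (hW : W.Nonempty) : I.Nonempty := by
  by_contra hI
  rw [Finset.not_nonempty_iff_eq_empty] at hI
  subst hI
  obtain ⟨w, hw⟩ := hW
  simpa using h.2.2 w hw (by simp)

theorem maxIndeps_nonempty_mem {r : α → α → Prop} {W I : Finset α} (hW : W.Nonempty)
    (hI : I ∈ maxIndeps r W) : ∃ x ∈ I, x ∈ W := by
  rw [mem_maxIndeps] at hI
  obtain ⟨x, hx⟩ := hI.nonempty hW
  exact ⟨x, hx, hI.1 hx⟩

theorem IsMaxClique.nonempty {r : α → α → Prop} {W K : Finset α} (h : IsMaxClique r W K)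
    (hW : W.Nonempty) : K.Nonempty := by
  by_contra hK
  rw [Finset.not_nonempty_iff_eq_empty] at hK
  subst hK
  obtain ⟨w, hw⟩ := hW
  simpa using h.2.2 w hw (by simp)

variable [DecidableEq α]

/-- `W` is split by `W₁` and `W₂` with all cross pairs satisfying `s`. -/
def SplitsBy (s : α → α → Prop) (W W₁ W₂ : Finset α) : Prop :=
  W₁.Nonempty ∧ W₂.Nonempty ∧ Disjoint W₁ W₂ ∧ W₁ ∪ W₂ = W ∧ ∀ a ∈ W₁, ∀ b ∈ W₂, s a b

theorem SplitsBy.of_subset {s : α → α → Prop} {W U : Finset α} (hU : U ⊆ W) (hne : U.Nonempty)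
    (hne' : (W \ U).Nonempty) (h : ∀ a ∈ U, ∀ b ∈ W, b ∉ U → s a b) :
    SplitsBy s W U (W \ U) :=
  ⟨hne, hne', Finset.disjoint_sdiff, Finset.union_sdiff_of_subset hU,
    fun a ha b hb => h a ha b (Finset.mem_sdiff.1 hb).1 (Finset.mem_sdiff.1 hb).2⟩

theorem SplitsBy.symm {s : α → α → Prop} (hs : ∀ a b, s a b → s b a) {W W₁ W₂ : Finset α}
    (h : SplitsBy s W W₁ W₂) : SplitsBy s W W₂ W₁ :=
  ⟨h.2.1, h.1, h.2.2.1.symm, by rw [Finset.union_comm]; exact h.2.2.2.1,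
    fun a ha b hb => hs _ _ (h.2.2.2.2 b hb a ha)⟩

/-- Adding a vertex to a disconnected set without creating an induced path. -/
theorem PathFree.exists_split_insert {r : α → α → Prop} (hs : ∀ a b, r a b → r b a)
    {v : α} {U U₁ U₂ : Finset α} (hv : v ∉ U) (h : PathFree r (insert v U))
    (hU : SplitsBy (fun a b => ¬ r a b) U U₁ U₂) :
    (∃ W₁ W₂, SplitsBy r (insert v U) W₁ W₂) ∨
      ∃ W₁ W₂, SplitsBy (fun a b => ¬ r a b) (insert v U) W₁ W₂ := by
  classical
  -- Either v is joined to all of V₁, or the enlarged set is disconnected.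
  have key : ∀ V₁ V₂ : Finset α, SplitsBy (fun a b => ¬ r a b) U V₁ V₂ →
      (∀ a ∈ V₁, r v a) ∨ ∃ W₁ W₂, SplitsBy (fun a b => ¬ r a b) (insert v U) W₁ W₂ := by
    rintro V₁ V₂ ⟨hn₁, hn₂, hd, rfl, hc⟩
    by_cases hz : ∃ z ∈ V₂, r v z
    · obtain ⟨z, hz, hvz⟩ := hz
      by_cases hm : ∀ a ∈ V₁, r v a
      · exact Or.inl hm
      right
      push Not at hm
      obtain ⟨u, hu, hvu⟩ := hm
      -- The non-neighbours of v in V₁ split off: an edge from one of them, a, to a neighbour b of v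
      -- in V₁ would give the induced path a, b, v, z.
      refine ⟨V₁.filter (fun a => ¬ r v a), _, SplitsBy.of_subset ?_ ⟨u, by simp [hu, hvu]⟩
        ⟨v, ?_⟩ ?_⟩
      · intro x hx
        simp only [Finset.mem_filter] at hx
        simp [hx.1]
      · simp only [Finset.mem_union, not_or] at hv
        simp [hv]
      · intro a ha b hb hb' hab
        simp only [Finset.mem_filter, Finset.mem_insert, Finset.mem_union] at ha hb hb'
        rcases hb with rfl | hb | hb
        · exact ha.2 (hs _ _ hab)
        · have hvb : r v b := by by_contra h'; exact hb' ⟨hb, h'⟩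
          have := h a (by simp [ha.1]) b (by simp [hb]) v (by simp) z (by simp [hz]) hab
            (hs _ _ hvb) hvz (by rintro rfl; exact hv (by simp [ha.1]))
            (fun h' => Finset.disjoint_left.1 hd hb (h' ▸ hz)) (fun h' => ha.2 (hs _ _ h'))
            (hc _ hb _ hz)
          exact hc _ ha.1 _ hz this
        · exact hc _ ha.1 _ hb hab
    · push Not at hz
      right
      refine ⟨V₂, _, SplitsBy.of_subset (fun x hx => by simp [hx]) hn₂ ⟨v, ?_⟩ ?_⟩
      · simp only [Finset.mem_union, not_or] at hv
        simp [hv]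
      · intro a ha b hb hb' hab
        simp only [Finset.mem_insert, Finset.mem_union] at hb
        rcases hb with rfl | hb | hb
        · exact hz a ha (hs _ _ hab)
        · exact hc _ hb _ ha (hs _ _ hab)
        · exact hb' hb
  rcases key U₁ U₂ hU with h₁ | h₁
  · rcases key U₂ U₁ (hU.symm fun a b h' h'' => h' (hs _ _ h'')) with h₂ | h₂
    · left
      obtain ⟨hn₁, hn₂, hd, rfl, hc⟩ := hU
      refine ⟨{v}, _, SplitsBy.of_subset (by simp) (by simp) ?_ ?_⟩
      · obtain ⟨x, hx⟩ := hn₁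
        exact ⟨x, by simp [hx]; rintro rfl; exact hv (by simp [hx])⟩
      · intro a ha b hb hb'
        simp only [Finset.mem_singleton, Finset.mem_insert, Finset.mem_union] at ha hb hb'
        subst ha
        rcases hb with hb | hb | hb
        · exact absurd hb hb'
        · exact h₁ b hb
        · exact h₂ b hb
    · exact Or.inr h₂
  · exact Or.inr h₁

/-- A path-free relation on at least two vertices is disconnected, or its complement is. -/
theorem PathFree.exists_split {r : α → α → Prop} (hs : ∀ a b, r a b → r b a)
    (W : Finset α) (h : PathFree r W) (hW : 2 ≤ W.card) :
    (∃ W₁ W₂, SplitsBy r W W₁ W₂) ∨ ∃ W₁ W₂, SplitsBy (fun a b => ¬ r a b) W W₁ W₂ := by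
  classical
  induction W using Finset.induction_on with
  | empty => simp at hW
  | insert v U hv ih =>
    rw [Finset.card_insert_of_notMem hv] at hW
    rcases Nat.lt_or_ge U.card 2 with hU | hU
    · obtain ⟨u, rfl⟩ := Finset.card_eq_one.1 (show U.card = 1 by omega)
      have hvu : v ≠ u := by simpa using hv
      have hsp : ∀ s : α → α → Prop, s v u → SplitsBy s (insert v {u}) {v} {u} := fun s hs' =>
        ⟨by simp, by simp, by simpa using hvu, rfl, by simpa using hs'⟩
      by_cases hr : r v u
      · exact Or.inl ⟨_, _, hsp _ hr⟩
      · exact Or.inr ⟨_, _, hsp _ hr⟩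
    · rcases ih (h.mono (Finset.subset_insert _ _)) hU with ⟨U₁, U₂, h'⟩ | ⟨U₁, U₂, h'⟩
      · have := PathFree.exists_split_insert (r := fun a b => a ≠ b ∧ ¬ r a b)
          (fun a b hab => ⟨hab.1.symm, fun h' => hab.2 (hs _ _ h')⟩) hv (h.compl hs)
          (U₁ := U₁) (U₂ := U₂) ⟨h'.1, h'.2.1, h'.2.2.1, h'.2.2.2.1, fun a ha b hb hab =>
            hab.2 (h'.2.2.2.2 a ha b hb)⟩
        rcases this with ⟨W₁, W₂, k⟩ | ⟨W₁, W₂, k⟩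
        · exact Or.inr ⟨W₁, W₂, k.1, k.2.1, k.2.2.1, k.2.2.2.1, fun a ha b hb =>
            (k.2.2.2.2 a ha b hb).2⟩
        · refine Or.inl ⟨W₁, W₂, k.1, k.2.1, k.2.2.1, k.2.2.2.1, fun a ha b hb => ?_⟩
          have := k.2.2.2.2 a ha b hb
          simp only [not_and, not_not] at this
          exact this (fun hab => Finset.disjoint_left.1 k.2.2.1 ha (hab ▸ hb))
      · exact PathFree.exists_split_insert hs hv h h'

/-- Induction along joins and disjoint unions. -/
theorem PathFree.induction {r : α → α → Prop} (hs : ∀ a b, r a b → r b a)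
    {motive : Finset α → Prop} (single : ∀ a, motive {a})
    (join : ∀ W W₁ W₂, SplitsBy r W W₁ W₂ → motive W₁ → motive W₂ → motive W)
    (union : ∀ W W₁ W₂, SplitsBy (fun a b => ¬ r a b) W W₁ W₂ → motive W₁ → motive W₂ →
      motive W)
    (W : Finset α) (h : PathFree r W) (hW : W.Nonempty) : motive W := by
  induction W using Finset.strongInduction with
  | H W ih =>
    have key : ∀ (s : α → α → Prop) (W₁ W₂ : Finset α), SplitsBy s W W₁ W₂ →
        motive W₁ ∧ motive W₂ := by
      rintro s W₁ W₂ ⟨hn₁, hn₂, hd, rfl, -⟩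
      constructor
      · refine ih _ ⟨Finset.subset_union_left, fun hh => ?_⟩ (h.mono Finset.subset_union_left) hn₁
        obtain ⟨x, hx⟩ := hn₂
        exact Finset.disjoint_left.1 hd (hh (Finset.mem_union_right _ hx)) hx
      · refine ih _ ⟨Finset.subset_union_right, fun hh => ?_⟩
          (h.mono Finset.subset_union_right) hn₂
        obtain ⟨x, hx⟩ := hn₁
        exact Finset.disjoint_left.1 hd hx (hh (Finset.mem_union_left _ hx))
    rcases Nat.lt_or_ge W.card 2 with hc | hc
    · obtain ⟨a, rfl⟩ := Finset.card_eq_one.1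
        (show W.card = 1 by have := hW.card_pos; omega)
      exact single a
    · rcases h.exists_split hs W hc with ⟨W₁, W₂, hsp⟩ | ⟨W₁, W₂, hsp⟩
      · exact join W W₁ W₂ hsp (key _ _ _ hsp).1 (key _ _ _ hsp).2
      · exact union W W₁ W₂ hsp (key _ _ _ hsp).1 (key _ _ _ hsp).2

/-- A maximal independent set of a join lies in one of the two sides. -/
theorem IsMaxIndep.of_join {r : α → α → Prop}
    {W W₁ W₂ I : Finset α} (hsp : SplitsBy r W W₁ W₂) (h : IsMaxIndep r W I) :
    IsMaxIndep r W₁ I ∨ IsMaxIndep r W₂ I := by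
  obtain ⟨hn₁, hn₂, hd, rfl, hc⟩ := hsp
  obtain ⟨x, hx⟩ := h.nonempty (hn₁.mono Finset.subset_union_left)
  rcases Finset.mem_union.1 (h.1 hx) with hx' | hx'
  · left
    refine ⟨fun y hy => ?_, h.2.1, fun w hw => h.2.2 w (Finset.mem_union_left _ hw)⟩
    exact (Finset.mem_union.1 (h.1 hy)).resolve_right fun hy' => h.2.1 x hx y hy (hc x hx' y hy')
  · right
    refine ⟨fun y hy => ?_, h.2.1, fun w hw => h.2.2 w (Finset.mem_union_right _ hw)⟩
    exact (Finset.mem_union.1 (h.1 hy)).resolve_left fun hy' => h.2.1 y hy x hx (hc y hy' x hx')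

/-- A maximal clique of a disjoint union lies in one of the two sides. -/
theorem IsMaxClique.of_union {r : α → α → Prop} {W W₁ W₂ K : Finset α}
    (hsp : SplitsBy (fun a b => ¬ r a b) W W₁ W₂) (h : IsMaxClique r W K) :
    IsMaxClique r W₁ K ∨ IsMaxClique r W₂ K := by
  obtain ⟨hn₁, hn₂, hd, rfl, hc⟩ := hsp
  obtain ⟨x, hx⟩ := h.nonempty (hn₁.mono Finset.subset_union_left)
  have hne : ∀ a ∈ W₁, ∀ b ∈ W₂, a ≠ b := fun a ha b hb hab =>
    Finset.disjoint_left.1 hd ha (hab ▸ hb)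
  rcases Finset.mem_union.1 (h.1 hx) with hx' | hx'
  · left
    refine ⟨fun y hy => ?_, h.2.1, fun w hw => h.2.2 w (Finset.mem_union_left _ hw)⟩
    exact (Finset.mem_union.1 (h.1 hy)).resolve_right fun hy' =>
      hc x hx' y hy' (h.2.1 x hx y hy (hne x hx' y hy'))
  · right
    refine ⟨fun y hy => ?_, h.2.1, fun w hw => h.2.2 w (Finset.mem_union_right _ hw)⟩
    exact (Finset.mem_union.1 (h.1 hy)).resolve_left fun hy' =>
      hc y hy' x hx' (h.2.1 y hy x hx (hne y hy' x hx'))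

theorem IsMaxClique.inter_join {r : α → α → Prop} (hs : ∀ a b, r a b → r b a)
    {W W₁ W₂ K : Finset α} (hsp : SplitsBy r W W₁ W₂) (h : IsMaxClique r W K) :
    IsMaxClique r W₁ (K ∩ W₁) ∧ IsMaxClique r W₂ (K ∩ W₂) := by
  obtain ⟨hn₁, hn₂, hd, rfl, hc⟩ := hsp
  refine ⟨⟨Finset.inter_subset_right, fun a ha b hb => h.2.1 a (Finset.mem_inter.1 ha).1 b
      (Finset.mem_inter.1 hb).1, fun w hw hwa => Finset.mem_inter.2 ⟨h.2.2 w
      (Finset.mem_union_left _ hw) fun a ha hne => ?_, hw⟩⟩,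
    ⟨Finset.inter_subset_right, fun a ha b hb => h.2.1 a (Finset.mem_inter.1 ha).1 b
      (Finset.mem_inter.1 hb).1, fun w hw hwa => Finset.mem_inter.2 ⟨h.2.2 w
      (Finset.mem_union_right _ hw) fun a ha hne => ?_, hw⟩⟩⟩
  · rcases Finset.mem_union.1 (h.1 ha) with ha' | ha'
    · exact hwa a (Finset.mem_inter.2 ⟨ha, ha'⟩) hne
    · exact hc w hw a ha'
  · rcases Finset.mem_union.1 (h.1 ha) with ha' | ha'
    · exact hs _ _ (hc a ha' w hw)
    · exact hwa a (Finset.mem_inter.2 ⟨ha, ha'⟩) hne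

theorem IsMaxIndep.inter_union {r : α → α → Prop} (hs : ∀ a b, r a b → r b a)
    {W W₁ W₂ I : Finset α} (hsp : SplitsBy (fun a b => ¬ r a b) W W₁ W₂)
    (h : IsMaxIndep r W I) : IsMaxIndep r W₁ (I ∩ W₁) ∧ IsMaxIndep r W₂ (I ∩ W₂) := by
  obtain ⟨hn₁, hn₂, hd, rfl, hc⟩ := hsp
  refine ⟨⟨Finset.inter_subset_right, fun a ha b hb => h.2.1 a (Finset.mem_inter.1 ha).1 b
      (Finset.mem_inter.1 hb).1, fun w hw hwa => Finset.mem_inter.2 ⟨h.2.2 w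
      (Finset.mem_union_left _ hw) fun a ha => ?_, hw⟩⟩,
    ⟨Finset.inter_subset_right, fun a ha b hb => h.2.1 a (Finset.mem_inter.1 ha).1 b
      (Finset.mem_inter.1 hb).1, fun w hw hwa => Finset.mem_inter.2 ⟨h.2.2 w
      (Finset.mem_union_right _ hw) fun a ha => ?_, hw⟩⟩⟩
  · rcases Finset.mem_union.1 (h.1 ha) with ha' | ha'
    · exact hwa a (Finset.mem_inter.2 ⟨ha, ha'⟩)
    · exact hc w hw a ha'
  · rcases Finset.mem_union.1 (h.1 ha) with ha' | ha'
    · exact fun h' => hc a ha' w hw (hs _ _ h')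
    · exact hwa a (Finset.mem_inter.2 ⟨ha, ha'⟩)

/-- In a path-free relation every maximal clique meets every maximal independent set. -/
theorem PathFree.exists_mem_clique_indep {r : α → α → Prop} (hs : ∀ a b, r a b → r b a)
    {W : Finset α} (h : PathFree r W) (hW : W.Nonempty) :
    ∀ K I, IsMaxClique r W K → IsMaxIndep r W I → ∃ a ∈ K, a ∈ I := by
  refine PathFree.induction hs (motive := fun W => ∀ K I, IsMaxClique r W K →
    IsMaxIndep r W I → ∃ a ∈ K, a ∈ I) ?_ ?_ ?_ W h hW
  · intro a K I hK hI
    obtain ⟨x, hx⟩ := hK.nonempty (by simp)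
    obtain ⟨y, hy⟩ := hI.nonempty (by simp)
    have hx' := Finset.mem_singleton.1 (hK.1 hx)
    have hy' := Finset.mem_singleton.1 (hI.1 hy)
    exact ⟨x, hx, by rw [hx', ← hy']; exact hy⟩
  · intro W W₁ W₂ hsp ih₁ ih₂ K I hK hI
    have hK' := hK.inter_join hs hsp
    rcases hI.of_join hsp with hI' | hI'
    · obtain ⟨a, ha, ha'⟩ := ih₁ _ _ hK'.1 hI'
      exact ⟨a, (Finset.mem_inter.1 ha).1, ha'⟩
    · obtain ⟨a, ha, ha'⟩ := ih₂ _ _ hK'.2 hI'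
      exact ⟨a, (Finset.mem_inter.1 ha).1, ha'⟩
  · intro W W₁ W₂ hsp ih₁ ih₂ K I hK hI
    have hI' := hI.inter_union hs hsp
    rcases hK.of_union hsp with hK' | hK'
    · obtain ⟨a, ha, ha'⟩ := ih₁ _ _ hK' hI'.1
      exact ⟨a, ha, (Finset.mem_inter.1 ha').1⟩
    · obtain ⟨a, ha, ha'⟩ := ih₂ _ _ hK' hI'.2
      exact ⟨a, ha, (Finset.mem_inter.1 ha').1⟩

/-- A maximal independent set of one side is nonempty, so every vertex of the other side is adjacent
to something in it and it stays maximal. Nonemptiness also keeps the two kinds distinct. -/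
theorem card_maxIndeps_join {r : α → α → Prop} (hs : ∀ a b, r a b → r b a)
    {W W₁ W₂ : Finset α} (hsp : SplitsBy r W W₁ W₂) :
    (maxIndeps r W₁).card + (maxIndeps r W₂).card ≤ (maxIndeps r W).card := by
  classical
  obtain ⟨hn₁, hn₂, hd, rfl, hc⟩ := hsp
  rw [← Finset.card_union_of_disjoint]
  · refine Finset.card_le_card fun I hI => ?_
    rw [mem_maxIndeps]
    rcases Finset.mem_union.1 hI with hI | hI
    · obtain ⟨x, hx, hxW⟩ := maxIndeps_nonempty_mem hn₁ hI
      rw [mem_maxIndeps] at hI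
      refine ⟨hI.1.trans Finset.subset_union_left, hI.2.1, fun w hw hwa => ?_⟩
      rcases Finset.mem_union.1 hw with hw | hw
      · exact hI.2.2 w hw hwa
      · exact absurd (hs _ _ (hc x hxW w hw)) (hwa x hx)
    · obtain ⟨x, hx, hxW⟩ := maxIndeps_nonempty_mem hn₂ hI
      rw [mem_maxIndeps] at hI
      refine ⟨hI.1.trans Finset.subset_union_right, hI.2.1, fun w hw hwa => ?_⟩
      rcases Finset.mem_union.1 hw with hw | hw
      · exact absurd (hc w hw x hxW) (hwa x hx)
      · exact hI.2.2 w hw hwa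
  · rw [Finset.disjoint_left]
    intro I h₁ h₂
    obtain ⟨x, hx, hxW⟩ := maxIndeps_nonempty_mem hn₁ h₁
    rw [mem_maxIndeps] at h₂
    exact Finset.disjoint_left.1 hd hxW (h₂.1 hx)

/-- Maximal independent sets of the two sides combine freely, and the union determines the pair. -/
theorem card_maxIndeps_union {r : α → α → Prop} (hs : ∀ a b, r a b → r b a)
    {W W₁ W₂ : Finset α} (hsp : SplitsBy (fun a b => ¬ r a b) W W₁ W₂) :
    (maxIndeps r W₁).card * (maxIndeps r W₂).card ≤ (maxIndeps r W).card := by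
  classical
  obtain ⟨hn₁, hn₂, hd, rfl, hc⟩ := hsp
  rw [← Finset.card_product]
  refine Finset.card_le_card_of_injOn (fun p => p.1 ∪ p.2) ?_ ?_
  · rintro ⟨I, J⟩ hp
    simp only [Finset.coe_product, Set.mem_prod, Finset.mem_coe, mem_maxIndeps] at hp ⊢
    obtain ⟨hI, hJ⟩ := hp
    refine ⟨Finset.union_subset_union hI.1 hJ.1, ?_, ?_⟩
    · intro a ha b hb
      rcases Finset.mem_union.1 ha with ha | ha <;> rcases Finset.mem_union.1 hb with hb | hb
      · exact hI.2.1 a ha b hb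
      · exact hc a (hI.1 ha) b (hJ.1 hb)
      · exact fun h' => hc b (hI.1 hb) a (hJ.1 ha) (hs _ _ h')
      · exact hJ.2.1 a ha b hb
    · intro w hw hwa
      rcases Finset.mem_union.1 hw with hw | hw
      · exact Finset.mem_union_left _ (hI.2.2 w hw fun a ha =>
          hwa a (Finset.mem_union_left _ ha))
      · exact Finset.mem_union_right _ (hJ.2.2 w hw fun a ha =>
          hwa a (Finset.mem_union_right _ ha))
  · rintro ⟨I, J⟩ hp ⟨I', J'⟩ hp' heq
    simp only [Finset.coe_product, Set.mem_prod, Finset.mem_coe, mem_maxIndeps] at hp hp' heq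
    have aux : ∀ {A B : Finset α}, A ⊆ W₁ → B ⊆ W₂ →
        (A ∪ B) ∩ W₁ = A ∧ (A ∪ B) ∩ W₂ = B := by
      intro A B hA hB
      rw [Finset.union_inter_distrib_right, Finset.union_inter_distrib_right,
        Finset.inter_eq_left.2 hA, Finset.inter_eq_left.2 hB,
        Finset.disjoint_iff_inter_eq_empty.1 (hd.mono_left hA),
        Finset.disjoint_iff_inter_eq_empty.1 (hd.symm.mono_left hB)]
      simp
    have h₁ := aux hp.1.1 hp.2.1
    have h₂ := aux hp'.1.1 hp'.2.1
    rw [heq] at h₁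
    rw [Prod.mk.injEq]
    exact ⟨h₁.1.symm.trans h₂.1, h₁.2.symm.trans h₂.2⟩

/-- Without domination there are at least as many maximal independent sets as vertices;
equality only occurs for joins of single vertices and four-cycles. -/
theorem PathFree.card_le_card_maxIndeps {r : α → α → Prop} (hs : ∀ a b, r a b → r b a)
    {W : Finset α} (h : PathFree r W) (hW : W.Nonempty) :
    (∀ a ∈ W, ¬ r a a) → NoDomination r W →
    W.card ≤ (maxIndeps r W).card ∧ (W.card = (maxIndeps r W).card →
      ∃ a b, W.card = 4 * a + b ∧ ∀ K, IsMaxClique r W K → K.card = 2 * a + b) := by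
  refine PathFree.induction hs (motive := fun W => (∀ a ∈ W, ¬ r a a) → NoDomination r W →
    W.card ≤ (maxIndeps r W).card ∧ (W.card = (maxIndeps r W).card →
      ∃ a b, W.card = 4 * a + b ∧ ∀ K, IsMaxClique r W K → K.card = 2 * a + b)) ?_ ?_ ?_ W h hW
  · intro a hi _
    refine ⟨?_, fun _ => ⟨0, 1, by simp, fun K hK => ?_⟩⟩
    · rw [Finset.card_singleton, Nat.succ_le_iff, Finset.card_pos]
      refine ⟨{a}, mem_maxIndeps.2 ⟨subset_rfl, ?_, fun w hw _ => hw⟩⟩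
      simpa using hi
    · have h₁ := (hK.nonempty (by simp)).card_pos
      have h₂ := Finset.card_le_card hK.1
      simp at h₂
      omega
  · intro W W₁ W₂ hsp ih₁ ih₂ hi hnd
    have hm := card_maxIndeps_join hs hsp
    have hsp' := hsp
    obtain ⟨hn₁, hn₂, hd, rfl, hc⟩ := hsp'
    rw [Finset.card_union_of_disjoint hd]
    -- The witness c is not adjacent to b, whereas the whole other side is; so c stays on this side.
    have h₁ := ih₁ (fun a ha => hi a (Finset.mem_union_left _ ha)) fun a ha b hb hab hr => by
      obtain ⟨c, hcW, hac, hbc⟩ := hnd a (Finset.mem_union_left _ ha) b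
        (Finset.mem_union_left _ hb) hab hr
      exact ⟨c, (Finset.mem_union.1 hcW).resolve_right fun h' => hbc (hc b hb c h'), hac, hbc⟩
    have h₂ := ih₂ (fun a ha => hi a (Finset.mem_union_right _ ha)) fun a ha b hb hab hr => by
      obtain ⟨c, hcW, hac, hbc⟩ := hnd a (Finset.mem_union_right _ ha) b
        (Finset.mem_union_right _ hb) hab hr
      exact ⟨c, (Finset.mem_union.1 hcW).resolve_left fun h' => hbc (hs _ _ (hc c h' b hb)),
        hac, hbc⟩
    refine ⟨by omega, fun heq => ?_⟩
    obtain ⟨a₁, b₁, hN₁, hK₁⟩ := h₁.2 (by omega)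
    obtain ⟨a₂, b₂, hN₂, hK₂⟩ := h₂.2 (by omega)
    refine ⟨a₁ + a₂, b₁ + b₂, by omega, fun K hK => ?_⟩
    have hK' := hK.inter_join hs hsp
    have e₁ := hK₁ _ hK'.1
    have e₂ := hK₂ _ hK'.2
    have : K.card = (K ∩ W₁).card + (K ∩ W₂).card := by
      rw [← Finset.card_union_of_disjoint (hd.mono Finset.inter_subset_right
        Finset.inter_subset_right), ← Finset.inter_union_distrib_left,
        Finset.inter_eq_left.2 hK.1]
    omega
  · intro W W₁ W₂ hsp ih₁ ih₂ hi hnd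
    have hm := card_maxIndeps_union hs hsp
    have hsp' := hsp
    obtain ⟨hn₁, hn₂, hd, rfl, hc⟩ := hsp'
    rw [Finset.card_union_of_disjoint hd]
    have hc' : ∀ a ∈ W₂, ∀ b ∈ W₁, ¬ r a b := fun a ha b hb h' => hc b hb a ha (hs _ _ h')
    have h₁ := ih₁ (fun a ha => hi a (Finset.mem_union_left _ ha)) fun a ha b hb hab hr => by
      obtain ⟨c, hcW, hac, hbc⟩ := hnd a (Finset.mem_union_left _ ha) b
        (Finset.mem_union_left _ hb) hab hr
      exact ⟨c, (Finset.mem_union.1 hcW).resolve_right fun h' => hc a ha c h' hac, hac, hbc⟩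
    have h₂ := ih₂ (fun a ha => hi a (Finset.mem_union_right _ ha)) fun a ha b hb hab hr => by
      obtain ⟨c, hcW, hac, hbc⟩ := hnd a (Finset.mem_union_right _ ha) b
        (Finset.mem_union_right _ hb) hab hr
      exact ⟨c, (Finset.mem_union.1 hcW).resolve_left fun h' => hc' a ha c h' hac, hac, hbc⟩
    obtain ⟨x, hx⟩ := hn₁
    obtain ⟨y, hy⟩ := hn₂
    have hxy : x ≠ y := fun h' => Finset.disjoint_left.1 hd hx (h' ▸ hy)
    -- The vertex x is not dominated by its non-neighbour y across the union, so x has a neighbour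
    -- on its own side.
    have l₁ : 2 ≤ W₁.card := by
      obtain ⟨c, hcW, hac, -⟩ := hnd x (Finset.mem_union_left _ hx) y
        (Finset.mem_union_right _ hy) hxy (hc x hx y hy)
      have hcW := (Finset.mem_union.1 hcW).resolve_right fun h' => hc x hx c h' hac
      exact Finset.one_lt_card.2 ⟨x, hx, c, hcW, fun h' =>
        hi x (Finset.mem_union_left _ hx) (by rw [← h'] at hac; exact hac)⟩
    have l₂ : 2 ≤ W₂.card := by
      obtain ⟨c, hcW, hac, -⟩ := hnd y (Finset.mem_union_right _ hy) x
        (Finset.mem_union_left _ hx) hxy.symm (hc' y hy x hx)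
      have hcW := (Finset.mem_union.1 hcW).resolve_left fun h' => hc' y hy c h' hac
      exact Finset.one_lt_card.2 ⟨y, hy, c, hcW, fun h' =>
        hi y (Finset.mem_union_right _ hy) (by rw [← h'] at hac; exact hac)⟩
    have hmul := Nat.mul_le_mul h₁.1 h₂.1
    have hadd : W₁.card + W₂.card ≤ W₁.card * W₂.card := by nlinarith
    refine ⟨by omega, fun heq => ?_⟩
    -- For sizes at least 2, sum equals product only at 2 + 2 = 2 · 2: the graph is two disjoint
    -- edges, with four vertices and maximal cliques of size 2, hence a = 1, b = 0.
    have heq' : W₁.card + W₂.card = W₁.card * W₂.card := by omega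
    have e₁ : W₁.card = 2 := by nlinarith
    have e₂ : W₂.card = 2 := by rw [e₁] at heq'; omega
    have hmm : (maxIndeps r W₁).card * (maxIndeps r W₂).card ≤ 4 := by
      rw [e₁, e₂] at heq; omega
    rw [e₁, e₂] at hmul
    obtain ⟨a₁, b₁, hN₁, hK₁⟩ := h₁.2 (by
      have := h₁.1; have := h₂.1; rw [e₁] at *; rw [e₂] at *; nlinarith)
    obtain ⟨a₂, b₂, hN₂, hK₂⟩ := h₂.2 (by
      have := h₁.1; have := h₂.1; rw [e₁] at *; rw [e₂] at *; nlinarith)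
    refine ⟨1, 0, by omega, fun K hK => ?_⟩
    rcases hK.of_union hsp with hK' | hK'
    · have := hK₁ K hK'
      omega
    · have := hK₂ K hK'
      omega

end Cograph

/-! ### Families in which every cover contains a partition -/

section Efficient

variable {α : Type*}

/-- The members of `S` cover the ground set. -/
def Covers (S : Finset (Finset α)) : Prop := ∀ x, ∃ A ∈ S, x ∈ A

/-- `T` is a partition of the ground set. -/
def IsSetPartition (T : Finset (Finset α)) : Prop :=
  Covers T ∧ ∀ A ∈ T, ∀ B ∈ T, A ≠ B → Disjoint A B

/-- Every covering subfamily of `F` contains a partition. -/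
def PartitionEfficient (F : Finset (Finset α)) : Prop :=
  ∀ S ⊆ F, Covers S → ∃ T ⊆ S, IsSetPartition T

open Classical in
/-- The members of `F` that belong to some partition contained in `F`. -/
noncomputable def essentialPart (F : Finset (Finset α)) : Finset (Finset α) :=
  F.filter (fun A => ∃ T ⊆ F, IsSetPartition T ∧ A ∈ T)

theorem mem_essentialPart {F : Finset (Finset α)} {A : Finset α} :
    A ∈ essentialPart F ↔ ∃ T ⊆ F, IsSetPartition T ∧ A ∈ T := by
  classical
  simp only [essentialPart, Finset.mem_filter, and_iff_right_iff_imp]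
  rintro ⟨T, hT, -, hA⟩
  exact hT hA

theorem essentialPart_subset (F : Finset (Finset α)) : essentialPart F ⊆ F := by
  classical
  exact Finset.filter_subset _ _

theorem IsSetPartition.subset_essentialPart {F T : Finset (Finset α)} (hT : IsSetPartition T)
    (hTF : T ⊆ F) : T ⊆ essentialPart F :=
  fun _ hA => mem_essentialPart.2 ⟨T, hTF, hT, hA⟩

theorem IsSetPartition.eq_of_mem {T : Finset (Finset α)} (hT : IsSetPartition T)
    {A B : Finset α} (hA : A ∈ T) (hB : B ∈ T) {x : α} (hxA : x ∈ A) (hxB : x ∈ B) : A = B := by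
  by_contra hne
  exact Finset.disjoint_left.1 (hT.2 A hA B hB hne) hxA hxB

variable [DecidableEq α]

/-- Two disjoint sets that lie in partitions contained in `F` lie in a common such partition. -/
theorem PartitionEfficient.exists_common_partition {F : Finset (Finset α)}
    (hF : PartitionEfficient F) {T₁ T₂ : Finset (Finset α)} (h₁ : T₁ ⊆ F) (h₂ : T₂ ⊆ F)
    (hT₁ : IsSetPartition T₁) (hT₂ : IsSetPartition T₂) {A B : Finset α} (hA : A ∈ T₁)
    (hB : B ∈ T₂) (hAn : A.Nonempty) (hBn : B.Nonempty) (hd : Disjoint A B) :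
    ∃ T ⊆ F, IsSetPartition T ∧ A ∈ T ∧ B ∈ T := by
  by_cases hA₂ : A ∈ T₂
  · exact ⟨T₂, h₂, hT₂, hA₂, hB⟩
  by_cases hB₁ : B ∈ T₁
  · exact ⟨T₁, h₁, hT₁, hA, hB₁⟩
  obtain ⟨a, ha⟩ := hAn
  obtain ⟨b, hb⟩ := hBn
  obtain ⟨D, hD, haD⟩ := hT₂.1 a
  obtain ⟨C, hC, hbC⟩ := hT₁.1 b
  have haB : a ∉ B := Finset.disjoint_left.1 hd ha
  have hbA : b ∉ A := Finset.disjoint_right.1 hd hb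
  have hD₁ : D ∉ T₁ := fun h => hA₂ (hT₁.eq_of_mem hA h ha haD ▸ hD)
  have hC₂ : C ∉ T₂ := fun h => hB₁ (hT₂.eq_of_mem hB h hb hbC ▸ hC)
  -- A point of P misses Q, so its member of T₂ survives; any other point keeps its member of T₁.
  have cover : ∀ P Q : Finset α, P ∉ T₂ → Q ∉ T₁ → Disjoint P Q →
      Covers ((T₁ ∪ T₂) \ {P, Q}) := by
    intro P Q hP hQ hPQ w
    obtain ⟨E, hE, hwE⟩ := hT₁.1 w
    obtain ⟨E', hE', hwE'⟩ := hT₂.1 w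
    by_cases hEP : E = P
    · by_cases hEQ : E' = Q
      · subst hEP hEQ
        exact absurd hwE' (Finset.disjoint_left.1 hPQ hwE)
      · refine ⟨E', ?_, hwE'⟩
        simp only [Finset.mem_sdiff, Finset.mem_union, Finset.mem_insert, Finset.mem_singleton]
        exact ⟨Or.inr hE', by rintro (rfl | rfl) <;> contradiction⟩
    · refine ⟨E, ?_, hwE⟩
      simp only [Finset.mem_sdiff, Finset.mem_union, Finset.mem_insert, Finset.mem_singleton]
      exact ⟨Or.inl hE, by rintro (rfl | rfl) <;> contradiction⟩
  have hsub : ∀ P : Finset (Finset α), (T₁ ∪ T₂) \ P ⊆ F := fun P =>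
    Finset.sdiff_subset.trans (Finset.union_subset h₁ h₂)
  -- Without A and B, only D can cover a and only C can cover b, so C and D lie in one partition and
  -- are disjoint. Discarding C and D in turn then forces A and B.
  obtain ⟨f, hf, hfp⟩ := hF _ (hsub _) (cover A B hA₂ hB₁ hd)
  have star_a : ∀ E ∈ T₁ ∪ T₂, a ∈ E → E = A ∨ E = D := fun E hE haE =>
    (Finset.mem_union.1 hE).imp (fun h => hT₁.eq_of_mem h hA haE ha)
      (fun h => hT₂.eq_of_mem h hD haE haD)
  have star_b : ∀ E ∈ T₁ ∪ T₂, b ∈ E → E = C ∨ E = B := fun E hE hbE =>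
    (Finset.mem_union.1 hE).imp (fun h => hT₁.eq_of_mem h hC hbE hbC)
      (fun h => hT₂.eq_of_mem h hB hbE hb)
  have hDf : D ∈ f := by
    obtain ⟨E, hE, haE⟩ := hfp.1 a
    have := Finset.mem_sdiff.1 (hf hE)
    rcases star_a E this.1 haE with rfl | rfl
    · simp at this
    · exact hE
  have hCf : C ∈ f := by
    obtain ⟨E, hE, hbE⟩ := hfp.1 b
    have := Finset.mem_sdiff.1 (hf hE)
    rcases star_b E this.1 hbE with rfl | rfl
    · exact hE
    · simp at this
  have hCD : Disjoint C D := hfp.2 C hCf D hDf (fun h => hD₁ (h ▸ hC))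
  obtain ⟨g, hg, hgp⟩ := hF _ (hsub _) (cover C D hC₂ hD₁ hCD)
  refine ⟨g, hg.trans (hsub _), hgp, ?_, ?_⟩
  · obtain ⟨E, hE, haE⟩ := hgp.1 a
    have := Finset.mem_sdiff.1 (hg hE)
    rcases star_a E this.1 haE with rfl | rfl
    · exact hE
    · simp at this
  · obtain ⟨E, hE, hbE⟩ := hgp.1 b
    have := Finset.mem_sdiff.1 (hg hE)
    rcases star_b E this.1 hbE with rfl | rfl
    · simp at this
    · exact hE

/-- Given a path A, B, C, D, take partitions through A, B and through C, D and discard B from the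
first, C from the second. The rest still covers as B and C are disjoint; a point of A ∩ C forces A
and a point of B ∩ D forces D into one partition. -/
theorem PartitionEfficient.pathFree_disjoint {F : Finset (Finset α)}
    (hF : PartitionEfficient F) (hne : ∀ A ∈ F, A.Nonempty) :
    PathFree Disjoint (essentialPart F) := by
  intro A hA B hB C hC D hD hAB hBC hCD hAC hBD hAC' hBD'
  have hn : ∀ A ∈ essentialPart F, A.Nonempty := fun A hA => hne A (essentialPart_subset F hA)
  have common : ∀ A ∈ essentialPart F, ∀ B ∈ essentialPart F, Disjoint A B →
      ∃ T ⊆ F, IsSetPartition T ∧ A ∈ T ∧ B ∈ T := by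
    intro A hA B hB hAB
    obtain ⟨T₁, h₁, hT₁, hA₁⟩ := mem_essentialPart.1 hA
    obtain ⟨T₂, h₂, hT₂, hB₂⟩ := mem_essentialPart.1 hB
    exact hF.exists_common_partition h₁ h₂ hT₁ hT₂ hA₁ hB₂ (hn A hA) (hn B hB) hAB
  obtain ⟨T₁, h₁, hT₁, hA₁, hB₁⟩ := common A hA B hB hAB
  obtain ⟨T₂, h₂, hT₂, hC₂, hD₂⟩ := common C hC D hD hCD
  obtain ⟨x, hxA, hxC⟩ := Finset.not_disjoint_iff.1 hAC'
  obtain ⟨y, hyB, hyD⟩ := Finset.not_disjoint_iff.1 hBD'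
  have hcov : Covers (T₁.erase B ∪ T₂.erase C) := by
    intro w
    obtain ⟨E, hE, hwE⟩ := hT₁.1 w
    obtain ⟨E', hE', hwE'⟩ := hT₂.1 w
    by_cases h : E = B
    · by_cases h' : E' = C
      · subst h h'
        exact absurd hwE' (Finset.disjoint_left.1 hBC hwE)
      · exact ⟨E', by simp [h', hE'], hwE'⟩
    · exact ⟨E, by simp [h, hE], hwE⟩
  obtain ⟨f, hf, hfp⟩ := hF _ (Finset.union_subset ((Finset.erase_subset _ _).trans h₁)
    ((Finset.erase_subset _ _).trans h₂)) hcov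
  have hAf : A ∈ f := by
    obtain ⟨E, hE, hxE⟩ := hfp.1 x
    rcases Finset.mem_union.1 (hf hE) with h | h
    · rwa [← hT₁.eq_of_mem (Finset.mem_of_mem_erase h) hA₁ hxE hxA]
    · exact absurd (hT₂.eq_of_mem (Finset.mem_of_mem_erase h) hC₂ hxE hxC)
        (Finset.ne_of_mem_erase h)
  have hDf : D ∈ f := by
    obtain ⟨E, hE, hyE⟩ := hfp.1 y
    rcases Finset.mem_union.1 (hf hE) with h | h
    · exact absurd (hT₁.eq_of_mem (Finset.mem_of_mem_erase h) hB₁ hyE hyB)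
        (Finset.ne_of_mem_erase h)
    · rwa [← hT₂.eq_of_mem (Finset.mem_of_mem_erase h) hD₂ hyE hyD]
  refine hfp.2 A hAf D hDf ?_
  rintro rfl
  exact hAC' hCD.symm

theorem IsSetPartition.isMaxClique {F T : Finset (Finset α)} (hne : ∀ A ∈ F, A.Nonempty)
    (hT : IsSetPartition T) (hTF : T ⊆ F) : IsMaxClique Disjoint (essentialPart F) T := by
  refine ⟨hT.subset_essentialPart hTF, hT.2, fun B hB h => ?_⟩
  obtain ⟨x, hx⟩ := hne B (essentialPart_subset F hB)
  obtain ⟨A, hA, hxA⟩ := hT.1 x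
  by_cases hBA : B = A
  · exact hBA ▸ hA
  · exact absurd hxA (Finset.disjoint_left.1 (h A hA hBA) hx)

/-- If B were disjoint from everything A is disjoint from, it would miss all other members of a
partition through A. Then B ⊆ A, and equal sizes give B = A. -/
theorem noDomination_essentialPart {F : Finset (Finset α)} {k : ℕ}
    (hk : ∀ A ∈ F, A.card = k) : NoDomination Disjoint (essentialPart F) := by
  intro A hA B hB hAB hd
  obtain ⟨T, hTF, hT, hAT⟩ := mem_essentialPart.1 hA
  by_contra! hcon
  have hsub : B ⊆ A := by
    intro x hx
    obtain ⟨C, hC, hxC⟩ := hT.1 x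
    by_cases hCA : A = C
    · exact hCA ▸ hxC
    · exact absurd hxC (Finset.disjoint_left.1
        (hcon C (hT.subset_essentialPart hTF hC) (hT.2 A hAT C hC hCA)) hx)
  refine hAB (Finset.eq_of_subset_of_card_le hsub ?_).symm
  rw [hk A (essentialPart_subset F hA), hk B (essentialPart_subset F hB)]

/-- Every maximal intersecting family of essential sets consists of all members of `F`
through some point. -/
theorem PartitionEfficient.exists_point [Nonempty α] {F : Finset (Finset α)} (hF : PartitionEfficient F)
    (hne : ∀ A ∈ F, A.Nonempty) {I : Finset (Finset α)}
    (hI : IsMaxIndep Disjoint (essentialPart F) I) : ∃ x, ∀ A ∈ F, x ∈ A ↔ A ∈ I := by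
  have hpf := hF.pathFree_disjoint hne
  have hW : ∀ T ⊆ F, IsSetPartition T → ∃ A ∈ T, A ∈ I := by
    intro T hTF hT
    have hWn : (essentialPart F).Nonempty := by
      obtain ⟨A, hA, -⟩ := hT.1 (Classical.arbitrary α)
      exact ⟨A, hT.subset_essentialPart hTF hA⟩
    exact hpf.exists_mem_clique_indep (fun _ _ h => h.symm) hWn T I
      (hT.isMaxClique hne hTF) hI
  -- Every partition in F is a maximal clique and so meets I.
  have hnc : ¬ Covers (F \ I) := by
    intro h
    obtain ⟨T, hTF, hT⟩ := hF _ Finset.sdiff_subset h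
    obtain ⟨A, hA, hAI⟩ := hW T (hTF.trans Finset.sdiff_subset) hT
    exact (Finset.mem_sdiff.1 (hTF hA)).2 hAI
  simp only [Covers, not_forall, not_exists, not_and] at hnc
  obtain ⟨x, hx⟩ := hnc
  have hxI : ∀ A ∈ F, x ∈ A → A ∈ I := by
    intro A hA hxA
    by_contra hAI
    exact hx A (Finset.mem_sdiff.2 ⟨hA, hAI⟩) hxA
  refine ⟨x, fun A hA => ⟨hxI A hA, fun hAI => ?_⟩⟩
  obtain ⟨T, hTF, hT, hAT⟩ := mem_essentialPart.1 (hI.1 hAI)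
  obtain ⟨B, hB, hxB⟩ := hT.1 x
  by_cases hAB : A = B
  · exact hAB ▸ hxB
  · exact absurd (hT.2 A hAT B hB hAB) (hI.2.1 A hAI B (hxI B (hTF hB) hxB))

end Efficient

/-! ### Binomial estimates and the size bound -/

section Counting

/-- The function C(j, k) - j is strictly increasing from j = k on: each step adds C(j, k - 1) - 1 ≥
k - 1 > 0. -/
theorem choose_add_lt_choose_add {a j k : ℕ} (hk : 2 ≤ k) (hj : k ≤ j) (hja : j < a) :
    j.choose k + a < a.choose k + j := by
  induction a, hja using Nat.le_induction with
  | base =>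
    obtain ⟨l, rfl⟩ : ∃ l, k = l + 1 := ⟨k - 1, by omega⟩
    have h := Nat.choose_succ_succ j l
    have h' := Nat.choose_le_choose l hj
    rw [Nat.choose_succ_self_right] at h'
    simp only [Nat.succ_eq_add_one] at *
    omega
  | succ m hm ih =>
    obtain ⟨l, rfl⟩ : ∃ l, k = l + 1 := ⟨k - 1, by omega⟩
    have h := Nat.choose_succ_succ m l
    have h' := Nat.choose_le_choose l (show l + 1 ≤ m by omega)
    rw [Nat.choose_succ_self_right] at h'
    simp only [Nat.succ_eq_add_one] at *
    omega

/-- The sum `m + (n - m).choose k` for `q ≤ m ≤ n` is largest at `m = q`, and elsewhere attains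
its maximum only for `m = n = 6`. -/
theorem add_choose_le {q k n m : ℕ} (hq : 2 ≤ q) (hk : 2 ≤ k) (hqk : (q, k) ≠ (2, 2))
    (hn : n = q * k) (hqm : q ≤ m) (hmn : m ≤ n) :
    m + (n - m).choose k ≤ (n - q).choose k + q ∧
      (m + (n - m).choose k = (n - q).choose k + q → m = q ∨
        m = 6 ∧ (q = 2 ∨ q = 3)) := by
  obtain ⟨a, ha⟩ : ∃ a, n = a + q := ⟨n - q, by omega⟩
  obtain ⟨j, hj⟩ : ∃ j, n = j + m := ⟨n - m, by omega⟩
  rw [show n - m = j by omega, show n - q = a by omega]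
  rcases Nat.eq_or_lt_of_le (show j ≤ a by omega) with rfl | hja
  · exact ⟨by omega, fun _ => Or.inl (by omega)⟩
  rcases Nat.lt_or_ge j k with hjk | hjk
  · rw [Nat.choose_eq_zero_of_lt hjk]
    obtain ⟨p, rfl⟩ : ∃ p, q = p + 2 := ⟨q - 2, by omega⟩
    obtain ⟨l, rfl⟩ : ∃ l, k = l + 2 := ⟨k - 2, by omega⟩
    -- This is where (2, 2) drops out: there n - q = k = 2 and C(2, 2) < 2.
    have hpl : p + l ≠ 0 := by
      intro h
      apply hqk
      rw [show p = 0 by omega, show l = 0 by omega]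
    have hprod : a = p * l + p + 2 * l + 2 := by nlinarith
    have hka : l + 3 ≤ a := by
      rw [hprod]
      have := Nat.zero_le (p * l)
      omega
    have hself := Nat.choose_succ_self_right (l + 2)
    rcases Nat.eq_or_lt_of_le hka with h | h
    · rw [← h, hself]
      refine ⟨by omega, fun heq => Or.inr ?_⟩
      have hlp : p * l + p + l = 1 := by omega
      rcases Nat.eq_zero_or_pos p with hp | hp
      · subst hp
        omega
      · have : l = 0 := by omega
        subst this
        omega
    · have := choose_add_lt_choose_add hk (show l + 2 ≤ l + 3 by omega) h
      rw [hself] at this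
      exact ⟨by omega, fun heq => by omega⟩
  · have := choose_add_lt_choose_add hk hjk hja
    exact ⟨by omega, fun heq => by omega⟩

variable {α : Type*} [DecidableEq α]

theorem IsSetPartition.sum_card_inter {T : Finset (Finset α)} (hT : IsSetPartition T)
    (X : Finset α) : ∑ A ∈ T, (A ∩ X).card = X.card := by
  rw [← Finset.card_biUnion]
  · congr 1
    ext x
    simp only [Finset.mem_biUnion, Finset.mem_inter]
    refine ⟨fun ⟨A, _, _, hx⟩ => hx, fun hx => ?_⟩
    obtain ⟨A, hA, hxA⟩ := hT.1 x
    exact ⟨A, hA, hxA, hx⟩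
  · intro A hA B hB hAB
    exact (hT.2 A hA B hB hAB).mono Finset.inter_subset_left Finset.inter_subset_left

theorem IsSetPartition.card_mul [Fintype α] {T : Finset (Finset α)} (hT : IsSetPartition T) {k : ℕ}
    (hk : ∀ A ∈ T, A.card = k) : T.card * k = Fintype.card α := by
  have := hT.sum_card_inter Finset.univ
  simp only [Finset.inter_univ, Finset.card_univ] at this
  rw [← this, Finset.sum_congr rfl hk, Finset.sum_const, smul_eq_mul]

/-- A set of points whose stars are distinct and consist of essential sets, at least as many
as there are essential sets. -/
theorem PartitionEfficient.exists_points [Nonempty α] {F : Finset (Finset α)} {k : ℕ}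
    (hF : PartitionEfficient F) (hcov : Covers F) (hk0 : 0 < k) (hk : ∀ A ∈ F, A.card = k) :
    ∃ X : Finset α, (essentialPart F).card ≤ X.card ∧
      ((essentialPart F).card = X.card → ∃ a b, X.card = 4 * a + b ∧
        ∀ T ⊆ F, IsSetPartition T → T.card = 2 * a + b) ∧
      (∀ x ∈ X, ∀ A ∈ F, x ∈ A → A ∈ essentialPart F) ∧
      ∀ x ∈ X, ∀ y ∈ X, (∀ A ∈ F, x ∈ A ↔ y ∈ A) → x = y := by
  have hne : ∀ A ∈ F, A.Nonempty := fun A hA => by rw [← Finset.card_pos, hk A hA]; exact hk0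
  obtain ⟨T, hTF, hT⟩ := hF F subset_rfl hcov
  have hWn : (essentialPart F).Nonempty := by
    obtain ⟨A, hA, -⟩ := hT.1 (Classical.arbitrary α)
    exact ⟨A, hT.subset_essentialPart hTF hA⟩
  have hI : ∀ I ∈ maxIndeps Disjoint (essentialPart F), ∃ x, ∀ A ∈ F, x ∈ A ↔ A ∈ I :=
    fun I hI => hF.exists_point hne (mem_maxIndeps.1 hI)
  choose! p hp using hI
  have hsub : ∀ I ∈ maxIndeps Disjoint (essentialPart F), I ⊆ essentialPart F :=
    fun I hI => (mem_maxIndeps.1 hI).1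
  have hpI : ∀ I ∈ maxIndeps Disjoint (essentialPart F),
      ∀ J ∈ maxIndeps Disjoint (essentialPart F),
        (∀ A ∈ F, p I ∈ A ↔ p J ∈ A) → I = J := by
    intro I hI J hJ h
    ext A
    by_cases hA : A ∈ F
    · rw [← hp I hI A hA, h A hA, hp J hJ A hA]
    · exact iff_of_false (fun h' => hA (essentialPart_subset F (hsub I hI h')))
        (fun h' => hA (essentialPart_subset F (hsub J hJ h')))
  have hcard : ((maxIndeps Disjoint (essentialPart F)).image p).card =
      (maxIndeps Disjoint (essentialPart F)).card :=
    Finset.card_image_of_injOn fun I hI J hJ h => hpI I hI J hJ fun A _ => by rw [h]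
  have hmain := (hF.pathFree_disjoint hne).card_le_card_maxIndeps (r := Disjoint)
    (fun _ _ h => h.symm) hWn
    (fun A hA h => (hne A (essentialPart_subset F hA)).ne_empty (disjoint_self.1 h))
    (noDomination_essentialPart hk)
  refine ⟨_, hcard ▸ hmain.1, fun h => ?_, ?_, ?_⟩
  · rw [hcard] at h
    obtain ⟨a, b, hab, hcl⟩ := hmain.2 h
    exact ⟨a, b, by rw [hcard, ← h, hab], fun T hTF hT => hcl T (hT.isMaxClique hne hTF)⟩
  · intro x hx A hA hxA
    obtain ⟨I, hI, rfl⟩ := Finset.mem_image.1 hx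
    exact hsub I hI ((hp I hI A hA).1 hxA)
  · intro x hx y hy h
    obtain ⟨I, hI, rfl⟩ := Finset.mem_image.1 hx
    obtain ⟨J, hJ, rfl⟩ := Finset.mem_image.1 hy
    rw [hpI I hI J hJ h]

variable [Fintype α]

/-- The bound on partition-efficient covering families of `k`-sets, with the structure of the
families that attain it. -/
theorem PartitionEfficient.card_le {F : Finset (Finset α)} {q k : ℕ} (hq : 2 ≤ q) (hk : 2 ≤ k)
    (hqk : (q, k) ≠ (2, 2)) (hn : Fintype.card α = q * k) (hF : PartitionEfficient F)
    (hcov : Covers F) (hFk : ∀ A ∈ F, A.card = k) :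
    F.card ≤ (Fintype.card α - q).choose k + q ∧
      (F.card = (Fintype.card α - q).choose k + q → ∃ (T : Finset (Finset α)) (X : Finset α),
        IsSetPartition T ∧ T.card = q ∧ (∀ A ∈ T, A.card = k) ∧ (∀ A ∈ T, (A ∩ X).card = 1) ∧
        F = T ∪ Finset.powersetCard k (Finset.univ \ X)) := by
  have : Nonempty α := Fintype.card_pos_iff.1 (by rw [hn]; positivity)
  obtain ⟨X, hX, hXeq, hXF, hinj⟩ := hF.exists_points hcov (by omega) hFk
  obtain ⟨T, hTF, hT⟩ := hF F subset_rfl hcov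
  have hTk : ∀ A ∈ T, A.card = k := fun A hA => hFk A (hTF hA)
  have hTq : T.card = q := Nat.eq_of_mul_eq_mul_right (by omega) ((hT.card_mul hTk).trans hn)
  have hqE : q ≤ (essentialPart F).card := hTq ▸ Finset.card_le_card (hT.subset_essentialPart hTF)
  have hXn : X.card ≤ Fintype.card α := X.card_le_univ
  have hrest : F \ essentialPart F ⊆ Finset.powersetCard k (Finset.univ \ X) := by
    intro A hA
    rw [Finset.mem_sdiff] at hA
    refine Finset.mem_powersetCard.2 ⟨fun x hx => ?_, hFk A hA.1⟩
    simp only [Finset.mem_sdiff, Finset.mem_univ, true_and]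
    exact fun hxX => hA.2 (hXF x hxX A hA.1 hx)
  have hcompl : (Finset.powersetCard k (Finset.univ \ X)).card =
      (Fintype.card α - X.card).choose k := by
    rw [Finset.card_powersetCard, Finset.card_sdiff_of_subset (Finset.subset_univ _),
      Finset.card_univ]
  have hrc := Finset.card_le_card hrest
  rw [hcompl] at hrc
  have hsum : (F \ essentialPart F).card + (essentialPart F).card = F.card :=
    Finset.card_sdiff_add_card_eq_card (essentialPart_subset F)
  have hnum := add_choose_le hq hk hqk hn (hqE.trans hX) hXn
  refine ⟨by omega, fun heq => ?_⟩
  have hXE : (essentialPart F).card = X.card := by omega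
  -- In the tie, 4a + b = 6 and 2a + b = q give 2a = 6 - q, impossible for q = 3 by parity and for q
  -- = 2 as b would be negative.
  have hXq : X.card = q := by
    rcases hnum.2 (by omega) with h | ⟨h, hq'⟩
    · exact h
    · obtain ⟨a, b, hab, hcl⟩ := hXeq hXE
      have := hcl T hTF hT
      omega
  have hET : essentialPart F = T :=
    (Finset.eq_of_subset_of_card_le (hT.subset_essentialPart hTF) (by omega)).symm
  refine ⟨T, X, hT, hTq, hTk, ?_, ?_⟩
  · have hle : ∀ A ∈ T, (A ∩ X).card ≤ 1 := by
      intro A hA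
      refine Finset.card_le_one.2 fun x hx y hy => ?_
      rw [Finset.mem_inter] at hx hy
      refine hinj x hx.2 y hy.2 fun B hB => ⟨fun h => ?_, fun h => ?_⟩
      · rw [hT.eq_of_mem (hET ▸ hXF x hx.2 B hB h) hA h hx.1]
        exact hy.1
      · rw [hT.eq_of_mem (hET ▸ hXF y hy.2 B hB h) hA h hy.1]
        exact hx.1
    refine (Finset.sum_eq_sum_iff_of_le hle).1 ?_
    rw [hT.sum_card_inter X, Finset.sum_const, smul_eq_mul, mul_one, hXq, hTq]
  · rw [← Finset.union_sdiff_of_subset (essentialPart_subset F), hET]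
    rw [hET] at hrest hsum
    rw [Finset.eq_of_subset_of_card_le hrest (by rw [hcompl, hXq]; omega)]

end Counting

/-! ### The extremal family and its uniqueness -/

section Extremal

variable {n q k : ℕ}

theorem covers_iff_sup {S : Finset (Finset (Fin n))} :
    Covers S ↔ S.sup id = Finset.univ := by
  simp [Covers, Finset.eq_univ_iff_forall]

/-- A cover of `[qk]` by `q` sets of size `k` is a partition. -/
theorem isSetPartition_of_card {T : Finset (Finset (Fin n))} (hn : n = q * k)
    (hk : ∀ A ∈ T, A.card = k) (hq : T.card = q) (hT : Covers T) : IsSetPartition T := by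
  refine ⟨hT, fun A hA B hB hAB => ?_⟩
  have hle : ∀ x ∈ (Finset.univ : Finset (Fin n)), 1 ≤ (T.filter (fun A => x ∈ A)).card := by
    intro x _
    obtain ⟨A, hA, hx⟩ := hT x
    exact Finset.card_pos.2 ⟨A, Finset.mem_filter.2 ⟨hA, hx⟩⟩
  have hsum : ∑ x : Fin n, (T.filter (fun A => x ∈ A)).card = ∑ A ∈ T, A.card := by
    have := Finset.sum_card_bipartiteAbove_eq_sum_card_bipartiteBelow
      (s := (Finset.univ : Finset (Fin n))) (t := T) (fun x A => x ∈ A)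
    simpa [Finset.bipartiteAbove, Finset.bipartiteBelow] using this
  -- There are qk = n incidences and each point has at least one, so each has exactly one.
  have heq := (Finset.sum_eq_sum_iff_of_le hle).1 (by
    rw [hsum, Finset.sum_congr rfl hk]
    simp [hq, hn])
  rw [Finset.disjoint_left]
  intro x hxA hxB
  exact hAB (Finset.card_le_one.1 (heq x (Finset.mem_univ x)).symm.le A
    (Finset.mem_filter.2 ⟨hA, hxA⟩) B (Finset.mem_filter.2 ⟨hB, hxB⟩))

theorem UnionEfficient.partitionEfficient {F : Finset (Finset (Fin n))} (hn : n = q * k)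
    (hk : F ⊆ Finset.powersetCard k Finset.univ) (hF : UnionEfficient q F) :
    PartitionEfficient F := by
  intro S hS hcov
  obtain ⟨T, hTS, hTq, hT⟩ := hF S hS (covers_iff_sup.1 hcov)
  exact ⟨T, hTS, isSetPartition_of_card hn
    (fun A hA => (Finset.mem_powersetCard.1 (hk (hS (hTS hA)))).2) hTq (covers_iff_sup.2 hT)⟩

/-- A numbering of a set that gives `0` to its only element in `X`. -/
theorem exists_numbering {α : Type*} [DecidableEq α] {A X : Finset α} (hA : A.card = k)
    (hX : (A ∩ X).card = 1) :
    ∃ f : α → ℕ, (∀ x ∈ A, ∀ y ∈ A, f x = f y → x = y) ∧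
      ∀ x ∈ A, f x < k ∧ (f x = 0 ↔ x ∈ X) := by
  obtain ⟨p, hp⟩ := Finset.card_eq_one.1 hX
  have hpA : p ∈ A := (Finset.mem_inter.1 (hp ▸ Finset.mem_singleton_self p)).1
  have hk : 0 < k := hA ▸ Finset.card_pos.2 ⟨p, hpA⟩
  let g := A.equivFinOfCardEq hA
  -- The swap moves the label 0 to p, the only point of A in X.
  let h := g.trans (Equiv.swap (g ⟨p, hpA⟩) ⟨0, hk⟩)
  refine ⟨fun x => if hx : x ∈ A then h ⟨x, hx⟩ else 0, fun x hx y hy hxy => ?_,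
    fun x hx => ⟨?_, ?_⟩⟩
  · simp only [hx, hy, dite_true] at hxy
    simpa using h.injective (Fin.ext hxy)
  · simp [hx]
  · have h0 : h ⟨p, hpA⟩ = ⟨0, hk⟩ := by simp [h]
    have hxX : x ∈ X ↔ x = p := by
      rw [← Finset.mem_singleton, ← hp, Finset.mem_inter, and_iff_right hx]
    simp only [hx, dite_true, hxX]
    refine ⟨fun hv => ?_, ?_⟩
    · have : h ⟨x, hx⟩ = h ⟨p, hpA⟩ := by rw [h0]; exact Fin.ext hv
      simpa using h.injective this
    · rintro rfl
      rw [h0]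

theorem mem_block {i : ℕ} {x : Fin n} : x ∈ block n k i ↔ x.val / k = i := by
  simp [block]

theorem mem_extremalFamily {A : Finset (Fin n)} : A ∈ extremalFamily n q k ↔
    (∃ i < q, block n k i = A) ∨ (∀ x ∈ A, ¬ k ∣ x.val) ∧ A.card = k := by
  simp [extremalFamily, Finset.mem_powersetCard, Finset.subset_iff]

/-- Families with the structure of the extremal one are isomorphic to it. -/
theorem familyIso_extremalFamily {T : Finset (Finset (Fin n))} {X : Finset (Fin n)}
    (hn : n = q * k) (hT : IsSetPartition T) (hTq : T.card = q) (hTk : ∀ A ∈ T, A.card = k)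
    (hX : ∀ A ∈ T, (A ∩ X).card = 1) :
    FamilyIso (T ∪ Finset.powersetCard k (Finset.univ \ X)) (extremalFamily n q k) := by
  let t := (T.equivFinOfCardEq hTq).symm
  have ht : ∀ i, (t i : Finset (Fin n)) ∈ T := fun i => (t i).2
  have hidx : ∀ x, ∃ i, x ∈ (t i : Finset (Fin n)) := by
    intro x
    obtain ⟨A, hA, hx⟩ := hT.1 x
    exact ⟨t.symm ⟨A, hA⟩, by simpa using hx⟩
  choose idx hidx using hidx
  have hidx' : ∀ x i, x ∈ (t i : Finset (Fin n)) ↔ idx x = i := by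
    refine fun x i => ⟨fun h => ?_, fun h => h ▸ hidx x⟩
    exact t.injective (Subtype.ext (hT.eq_of_mem (ht _) (ht i) (hidx x) h))
  choose f hfinj hf using fun i => exists_numbering (hTk _ (ht i)) (hX _ (ht i))
  have hlt : ∀ x, f (idx x) x < k := fun x => (hf _ x (hidx x)).1
  have hbound : ∀ x, k * (idx x).val + f (idx x) x < n := by
    intro x
    have := hlt x
    have h' : k * ((idx x).val + 1) ≤ k * q := Nat.mul_le_mul_left k (idx x).2
    rw [Nat.mul_succ] at h'
    rw [hn, Nat.mul_comm q k]
    omega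
  let s : Fin n → Fin n := fun x => ⟨k * (idx x).val + f (idx x) x, hbound x⟩
  have hdiv : ∀ x, (s x).val / k = (idx x).val := fun x => by
    rw [Nat.mul_add_div (Nat.zero_lt_of_lt (hlt x)), Nat.div_eq_of_lt (hlt x), add_zero]
  have hmod : ∀ x, (s x).val % k = f (idx x) x := fun x => by
    rw [Nat.mul_add_mod, Nat.mod_eq_of_lt (hlt x)]
  have hinj : Function.Injective s := by
    intro x y hxy
    have h₁ : idx x = idx y := Fin.ext (by rw [← hdiv, ← hdiv, hxy])
    have h₂ : f (idx x) x = f (idx x) y := by rw [← hmod x, hxy, hmod y, h₁]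
    exact hfinj (idx x) x (hidx x) y (by rw [h₁]; exact hidx y) h₂
  let σ : Equiv.Perm (Fin n) := Equiv.ofBijective s (Finite.injective_iff_bijective.1 hinj)
  have hσ : ∀ x, σ x = s x := fun x => rfl
  have hdvd : ∀ x, k ∣ (σ x).val ↔ x ∈ X := fun x => by
    rw [Nat.dvd_iff_mod_eq_zero, hσ, hmod, (hf _ x (hidx x)).2]
  have hblock : ∀ i, (t i : Finset (Fin n)).image σ = block n k i := by
    intro i
    ext y
    obtain ⟨x, rfl⟩ := σ.surjective y
    rw [Function.Injective.mem_finset_image σ.injective, mem_block, hidx', hσ, hdiv, Fin.ext_iff]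
  refine ⟨σ, ?_⟩
  ext B
  simp only [Finset.mem_image, Finset.mem_union, Finset.mem_powersetCard, mem_extremalFamily]
  constructor
  · rintro ⟨A, hA | ⟨hA, hAk⟩, rfl⟩
    · left
      refine ⟨(t.symm ⟨A, hA⟩).val, (t.symm ⟨A, hA⟩).2, ?_⟩
      rw [← hblock]
      simp
    · right
      refine ⟨fun y hy => ?_, by rw [Finset.card_image_of_injective _ σ.injective, hAk]⟩
      obtain ⟨x, hx, rfl⟩ := Finset.mem_image.1 hy
      rw [hdvd]
      exact (Finset.mem_sdiff.1 (hA hx)).2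
  · rintro (⟨i, hi, rfl⟩ | ⟨hB, hBk⟩)
    · exact ⟨t ⟨i, hi⟩, Or.inl (ht _), hblock ⟨i, hi⟩⟩
    · refine ⟨B.image σ.symm, Or.inr ⟨fun x hx => ?_, ?_⟩, ?_⟩
      · obtain ⟨y, hy, rfl⟩ := Finset.mem_image.1 hx
        rw [Finset.mem_sdiff, ← hdvd, σ.apply_symm_apply]
        exact ⟨Finset.mem_univ _, hB y hy⟩
      · rw [Finset.card_image_of_injective _ σ.symm.injective, hBk]
      · rw [Finset.image_image]
        simp

theorem card_block (hn : n = q * k) {i : ℕ} (hi : i < q) : (block n k i).card = k := by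
  rcases Nat.eq_zero_or_pos k with rfl | hk
  · subst hn
    simp [block]
  rw [← Finset.card_map Fin.valEmbedding]
  have : (block n k i).map Fin.valEmbedding = Finset.Ico (i * k) (i * k + k) := by
    ext x
    simp only [Finset.mem_map, mem_block, Fin.valEmbedding_apply, Finset.mem_Ico]
    rw [← Nat.succ_mul]
    constructor
    · rintro ⟨y, hy, rfl⟩
      have := (Nat.div_eq_iff hk).1 hy
      rw [Nat.succ_mul]
      omega
    · rintro ⟨h₁, h₂⟩
      have h₃ : (i + 1) * k ≤ q * k := Nat.mul_le_mul_right k hi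
      exact ⟨⟨x, by rw [hn]; exact h₂.trans_le h₃⟩, Nat.div_eq_of_lt_le h₁ h₂, rfl⟩
  rw [this]
  simp

theorem isSetPartition_blocks (hn : n = q * k) :
    IsSetPartition ((Finset.range q).image (block n k)) := by
  refine ⟨fun x => ?_, ?_⟩
  · refine ⟨_, Finset.mem_image_of_mem _ (Finset.mem_range.2 ?_), mem_block.2 rfl⟩
    exact Nat.div_lt_of_lt_mul (by rw [Nat.mul_comm, ← hn]; exact x.2)
  · intro A hA B hB hAB
    obtain ⟨i, -, rfl⟩ := Finset.mem_image.1 hA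
    obtain ⟨j, -, rfl⟩ := Finset.mem_image.1 hB
    rw [Finset.disjoint_left]
    intro x hx hy
    rw [mem_block] at hx hy
    exact hAB (by rw [← hx, ← hy])

theorem card_of_mem_blocks (hn : n = q * k) :
    ∀ A ∈ (Finset.range q).image (block n k), A.card = k := by
  intro A hA
  obtain ⟨i, hi, rfl⟩ := Finset.mem_image.1 hA
  exact card_block hn (Finset.mem_range.1 hi)

theorem card_blocks (hn : n = q * k) (hk : 0 < k) :
    ((Finset.range q).image (block n k)).card = q :=
  Nat.eq_of_mul_eq_mul_right hk
    (((isSetPartition_blocks hn).card_mul (card_of_mem_blocks hn)).trans (by simp [hn]))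

theorem exists_private_mem_block (hn : n = q * k) (hk : 0 < k) {i : ℕ} (hi : i < q) :
    ∃ p : Fin n, k ∣ p.val ∧ ∀ j, p ∈ block n k j ↔ j = i := by
  refine ⟨⟨i * k, by rw [hn]; exact Nat.mul_lt_mul_of_pos_right hi hk⟩, Dvd.intro_left i rfl,
    fun j => ?_⟩
  rw [mem_block, Nat.mul_div_cancel _ hk, eq_comm]

theorem card_private (hn : n = q * k) (hk : 0 < k) :
    (Finset.univ.filter (fun x : Fin n => k ∣ x.val)).card = q := by
  rw [← (isSetPartition_blocks hn).sum_card_inter, Finset.sum_congr rfl (g := fun _ => 1),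
    Finset.sum_const, card_blocks hn hk, smul_eq_mul, mul_one]
  intro A hA
  obtain ⟨i, hi, rfl⟩ := Finset.mem_image.1 hA
  obtain ⟨p, hp, hpi⟩ := exists_private_mem_block hn hk (Finset.mem_range.1 hi)
  refine Finset.card_eq_one.2 ⟨p, ?_⟩
  ext x
  simp only [Finset.mem_inter, Finset.mem_filter, Finset.mem_univ, true_and,
    Finset.mem_singleton]
  constructor
  · rintro ⟨hx, hkx⟩
    have hpb := (hpi i).2 rfl
    rw [mem_block] at hx hpb
    exact Fin.ext (by rw [← Nat.div_mul_cancel hkx, ← Nat.div_mul_cancel hp, hx, hpb])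
  · rintro rfl
    exact ⟨(hpi i).2 rfl, hp⟩

theorem extremalFamily_subset (hn : n = q * k) :
    extremalFamily n q k ⊆ Finset.powersetCard k Finset.univ := by
  intro A hA
  refine Finset.mem_powersetCard.2 ⟨Finset.subset_univ _, ?_⟩
  rcases mem_extremalFamily.1 hA with ⟨i, hi, rfl⟩ | h
  · exact card_block hn hi
  · exact h.2

theorem unionNontrivial_extremalFamily (hn : n = q * k) :
    UnionNontrivial (extremalFamily n q k) := by
  refine covers_iff_sup.1 fun x => ?_
  obtain ⟨A, hA, hx⟩ := (isSetPartition_blocks hn).1 x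
  exact ⟨A, Finset.mem_union_left _ hA, hx⟩

/-- The private element of a block lies in no other member, so every covering subfamily contains all
q blocks. -/
theorem unionEfficient_extremalFamily (hn : n = q * k) (hk : 0 < k) :
    UnionEfficient q (extremalFamily n q k) := by
  intro S hS hcov
  refine ⟨_, ?_, card_blocks hn hk, covers_iff_sup.1 (isSetPartition_blocks hn).1⟩
  intro A hA
  obtain ⟨i, hi, rfl⟩ := Finset.mem_image.1 hA
  obtain ⟨p, hp, hpi⟩ := exists_private_mem_block hn hk (Finset.mem_range.1 hi)
  obtain ⟨B, hB, hpB⟩ := covers_iff_sup.2 hcov p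
  rcases mem_extremalFamily.1 (hS hB) with ⟨j, -, rfl⟩ | h
  · exact (hpi j).1 hpB ▸ hB
  · exact absurd hp (h.1 p hpB)

theorem card_extremalFamily (hn : n = q * k) (hk : 0 < k) :
    (extremalFamily n q k).card = (n - q).choose k + q := by
  rw [extremalFamily, Finset.card_union_of_disjoint, card_blocks hn hk,
    Finset.card_powersetCard, Finset.filter_not,
    Finset.card_sdiff_of_subset (Finset.subset_univ _), card_private hn hk, Finset.card_univ,
    Fintype.card_fin, add_comm]
  rw [Finset.disjoint_left]
  intro A hA hA'
  obtain ⟨i, hi, rfl⟩ := Finset.mem_image.1 hA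
  obtain ⟨p, hp, hpi⟩ := exists_private_mem_block hn hk (Finset.mem_range.1 hi)
  have := (Finset.mem_powersetCard.1 hA').1 ((hpi i).2 rfl)
  exact (Finset.mem_filter.1 this).2 hp

end Extremal

/-! ### Passing to complements: the Helly form -/

section Complement

variable {n q k : ℕ}

theorem complFamily_complFamily (F : Finset (Finset (Fin n))) :
    complFamily (complFamily F) = F := by
  simp [complFamily, Finset.image_image, Function.comp_def]

theorem card_complFamily (F : Finset (Finset (Fin n))) : (complFamily F).card = F.card := by
  refine Finset.card_image_of_injective _ fun A B h => ?_
  rw [← Finset.compl_eq_univ_sdiff, ← Finset.compl_eq_univ_sdiff] at h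
  exact compl_injective h

theorem complFamily_mono {F G : Finset (Finset (Fin n))} (h : F ⊆ G) :
    complFamily F ⊆ complFamily G :=
  Finset.image_subset_image h

theorem complFamily_subset_powersetCard {F : Finset (Finset (Fin n))} {l : ℕ}
    (hF : F ⊆ Finset.powersetCard k Finset.univ) (hl : n = l + k) :
    complFamily F ⊆ Finset.powersetCard l Finset.univ := by
  intro B hB
  obtain ⟨A, hA, rfl⟩ := Finset.mem_image.1 hB
  have := (Finset.mem_powersetCard.1 (hF hA)).2
  refine Finset.mem_powersetCard.2 ⟨Finset.subset_univ _, ?_⟩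
  rw [Finset.card_sdiff_of_subset (Finset.subset_univ _), Finset.card_univ, Fintype.card_fin]
  omega

theorem exists_mem_complFamily_iff {F : Finset (Finset (Fin n))} :
    (∃ x, ∀ A ∈ complFamily F, x ∈ A) ↔ ¬ Covers F := by
  simp [complFamily, Covers]

theorem interNontrivial_complFamily {F : Finset (Finset (Fin n))} :
    InterNontrivial (complFamily F) ↔ UnionNontrivial F := by
  rw [InterNontrivial, exists_mem_complFamily_iff, not_not, covers_iff_sup, UnionNontrivial]

/-- For `k`-subsets of `[qk]`, the complements are `q`-linked unless `q` of the sets cover. -/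
theorem linked_complFamily_iff {S : Finset (Finset (Fin n))} (hn : n = q * k) (hk : 0 < k)
    (hS : S ⊆ Finset.powersetCard k Finset.univ) :
    Linked q (complFamily S) ↔ ¬ ∃ T ⊆ S, T.card = q ∧ T.sup id = Finset.univ := by
  constructor
  · rintro hL ⟨T, hTS, hTq, hT⟩
    let t := (T.equivFinOfCardEq hTq).symm
    obtain ⟨x, hx⟩ := hL (fun i => Finset.univ \ (t i : Finset (Fin n)))
      (fun i => Finset.mem_image_of_mem _ (hTS (t i).2))
    obtain ⟨A, hA, hxA⟩ := covers_iff_sup.2 hT x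
    have := hx (t.symm ⟨A, hA⟩)
    simp [hxA] at this
  · intro h A hA
    by_contra! hcon
    have hsub : Finset.univ.image (fun i => Finset.univ \ A i) ⊆ S := by
      intro B hB
      obtain ⟨i, -, rfl⟩ := Finset.mem_image.1 hB
      rw [← complFamily_complFamily S]
      exact Finset.mem_image_of_mem _ (hA i)
    have hcov : (Finset.univ.image (fun i => Finset.univ \ A i)).sup id = Finset.univ := by
      refine covers_iff_sup.1 fun x => ?_
      obtain ⟨i, hi⟩ := hcon x
      exact ⟨_, Finset.mem_image_of_mem _ (Finset.mem_univ i), by simp [hi]⟩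
    refine h ⟨_, hsub, le_antisymm (Finset.card_image_le.trans (by simp)) ?_, hcov⟩
    -- Covering qk points by k-sets takes at least q of them, so the q complements cannot repeat.
    refine Nat.le_of_mul_le_mul_right ?_ hk
    have := Finset.card_biUnion_le_card_mul (Finset.univ.image (fun i => Finset.univ \ A i)) id k
      (fun B hB => (Finset.mem_powersetCard.1 (hS (hsub hB))).2.le)
    rw [← Finset.sup_eq_biUnion, hcov, Finset.card_univ, Fintype.card_fin] at this
    exact hn.symm.le.trans this

/-- A common element of the complements is an uncovered point, so each condition is the
contrapositive of the other, subfamily by subfamily. -/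
theorem hellyFamily_complFamily {F : Finset (Finset (Fin n))} (hn : n = q * k) (hk : 0 < k)
    (hF : F ⊆ Finset.powersetCard k Finset.univ) :
    HellyFamily q (complFamily F) ↔ UnionEfficient q F := by
  have key : ∀ S ⊆ F, ((Linked q (complFamily S) → ∃ x, ∀ A ∈ complFamily S, x ∈ A) ↔
      (S.sup id = Finset.univ → ∃ T ⊆ S, T.card = q ∧ T.sup id = Finset.univ)) := by
    intro S hS
    rw [linked_complFamily_iff hn hk (hS.trans hF), exists_mem_complFamily_iff, covers_iff_sup,
      not_imp_not]
  constructor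
  · exact fun h S hS => (key S hS).1 (h _ (complFamily_mono hS))
  · intro h S hS
    have hS' : complFamily S ⊆ F := complFamily_complFamily F ▸ complFamily_mono hS
    have := (key _ hS').2 (h _ hS')
    rwa [complFamily_complFamily] at this

theorem FamilyIso.complFamily {F G : Finset (Finset (Fin n))} (h : FamilyIso F G) :
    FamilyIso (complFamily F) (complFamily G) := by
  obtain ⟨σ, rfl⟩ := h
  refine ⟨σ, ?_⟩
  simp only [_root_.complFamily, Finset.image_image]
  congr 1
  ext A x
  simp [Finset.image_sdiff _ _ σ.injective]

end Complement

/-- The union form of the bound, with uniqueness. -/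
theorem UnionEfficient.card_le {n q k : ℕ} (hq : 2 ≤ q) (hk : 2 ≤ k) (hqk : (q, k) ≠ (2, 2))
    (hn : n = q * k) {F : Finset (Finset (Fin n))} (hF : F ⊆ Finset.powersetCard k Finset.univ)
    (hcov : UnionNontrivial F) (heff : UnionEfficient q F) :
    F.card ≤ (n - q).choose k + q ∧
      (F.card = (n - q).choose k + q → FamilyIso F (extremalFamily n q k)) := by
  have h := (heff.partitionEfficient hn hF).card_le hq hk hqk (by simpa using hn)
    (covers_iff_sup.2 hcov) (fun A hA => (Finset.mem_powersetCard.1 (hF hA)).2)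
  rw [Fintype.card_fin] at h
  refine ⟨h.1, fun heq => ?_⟩
  obtain ⟨T, X, hT, hTq, hTk, hX, rfl⟩ := h.2 heq
  exact familyIso_extremalFamily hn hT hTq hTk hX

theorem theorem1p7 (n q k : ℕ) (hq : 2 ≤ q) (hk : 2 ≤ k) (hqk : (q, k) ≠ (2, 2))
    (hn : n = q * k) :
    -- the union form: upper bound and uniqueness
    (∀ F : Finset (Finset (Fin n)), F ⊆ Finset.powersetCard k Finset.univ →
      UnionNontrivial F → UnionEfficient q F →
        F.card ≤ (n - q).choose k + q ∧
        (F.card = (n - q).choose k + q → FamilyIso F (extremalFamily n q k))) ∧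
    -- the union form: the extremal family is admissible and attains the bound
    (extremalFamily n q k ⊆ Finset.powersetCard k Finset.univ ∧
      UnionNontrivial (extremalFamily n q k) ∧ UnionEfficient q (extremalFamily n q k) ∧
      (extremalFamily n q k).card = (n - q).choose k + q) ∧
    -- the Helly form, for sets of size (q - 1) k, that is, n = ((q - 1) k) q / (q - 1)
    (∀ H : Finset (Finset (Fin n)), H ⊆ Finset.powersetCard ((q - 1) * k) Finset.univ →
      InterNontrivial H → HellyFamily q H →
        H.card ≤ (n - q).choose k + q ∧
        (H.card = (n - q).choose k + q →
          FamilyIso H (complFamily (extremalFamily n q k)))) ∧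
    (complFamily (extremalFamily n q k) ⊆ Finset.powersetCard ((q - 1) * k) Finset.univ ∧
      InterNontrivial (complFamily (extremalFamily n q k)) ∧
      HellyFamily q (complFamily (extremalFamily n q k)) ∧
      (complFamily (extremalFamily n q k)).card = (n - q).choose k + q) := by
  have hk0 : 0 < k := by omega
  have hn' : n = (q - 1) * k + k := by
    rw [← Nat.succ_mul, hn]
    congr 1
    omega
  have hE := extremalFamily_subset (n := n) hn
  refine ⟨fun F hF hcov heff => heff.card_le hq hk hqk hn hF hcov,
    ⟨hE, unionNontrivial_extremalFamily hn, unionEfficient_extremalFamily hn hk0,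
      card_extremalFamily hn hk0⟩,
    fun H hH hnt hhelly => ?_,
    complFamily_subset_powersetCard hE hn',
    interNontrivial_complFamily.2 (unionNontrivial_extremalFamily hn),
    (hellyFamily_complFamily hn hk0 hE).2 (unionEfficient_extremalFamily hn hk0),
    (card_complFamily _).trans (card_extremalFamily hn hk0)⟩
  have hF := complFamily_subset_powersetCard hH (hn'.trans (add_comm _ _))
  rw [← complFamily_complFamily H] at hnt hhelly
  have h := ((hellyFamily_complFamily hn hk0 hF).1 hhelly).card_le hq hk hqk hn hF
    (interNontrivial_complFamily.1 hnt)
  rw [card_complFamily] at h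
  refine ⟨h.1, fun heq => ?_⟩
  rw [← complFamily_complFamily H]
  exact (h.2 heq).complFamily
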